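/- Let $1<\alpha<2$ and $\kappa=1/\alpha$. Let $(Z_t)_{t\ge 0}$ be a real $\alpha$-stable Lévy process with Lévy triplet $(0,\nu_Z,\gamma)$, where $\nu_Z(\mathrm dz)=(A\mathbf 1_{z>0}+B\mathbf 1_{z<0})|z|^{-(\alpha+1)}\,\mathrm dz$ for constants $A,B\ge 0$ that are not both $0$, and $\gamma\in\mathbb R$; assume that $Z$ is a martingale in its natural filtration. Let $(\zeta_t)_{t\ge 0}$ be a subordinator (a Lévy process with nondecreasing paths) independent of $Z$. For $a\in\mathbb R$ put $$X^{(a)}_t=t^{\kappa}e^{-\kappa\zeta_{a+\ln t}}\,Z_{\exp(\zeta_{a+\ln t})},\qquad t\ge e^{-a}.$$ Let $(X_t)_{t\ge 0}$ be the mimic of $Z$ constructed from $\zeta$, i.e. a process on some probability space with $X_0=0$ a.s. such that for every $a\in\mathbb R$ the processes $(X_t)_{t\ge e^{-a}}$ and $(X^{(a)}_t)_{t\ge e^{-a}}$ have the same finite-dimensional distributions. (The case of martingale mimics is the one where $\mathbb E[e^{-\kappa\zeta_1}]=e^{-\kappa}$; this is not needed for the representation.) Then, on a suitable enlargement of the probability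 space of $X$, there are random variables $R_{s,t}$, $\xi_{s,t}$, $0<s\le t$, such that for all $0<s\le t$, almost surely, $$X_t=(t/s)^{\kappa}\bigl(R_{s,t}^{\kappa}X_s+s^{\kappa}(1-R_{s,t})^{\kappa}\xi_{s,t}\bigr),$$ where $R_{s,t}\stackrel{d}{=}e^{-\zeta_{\ln(t/s)}}$, $\xi_{s,t}\stackrel{d}{=}Z_1$, and $R_{s,t}$, $\xi_{s,t}$, $X_s$ are independent. -/

import Mathlib

open MeasureTheory ProbabilityTheory Filter Topology
open scoped NNReal

universe v

namespace StableMimic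

/-- A path indexed by `[0, ∞)` is càdlàg: right-continuous with finite left limits. -/
def IsCadlag (f : ℝ≥0 → ℝ) : Prop :=
  ∀ t, ContinuousWithinAt f (Set.Ioi t) t ∧ ∃ l : ℝ, Tendsto f (𝓝[<] t) (𝓝 l)

/-- A real Lévy process: it starts at `0`, has independent and stationary increments and
càdlàg paths (almost surely). -/
structure IsLevyProcess {Ω : Type*} [MeasurableSpace Ω] (Z : ℝ≥0 → Ω → ℝ) (P : Measure Ω) :
    Prop where
  measurable : ∀ t, Measurable (Z t)
  zero : ∀ᵐ ω ∂P, Z 0 ω = 0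
  indepIncrements : HasIndepIncrements Z P
  stationary : ∀ s h : ℝ≥0, IdentDistrib (fun ω => Z (s + h) ω - Z s ω) (Z h) P P
  cadlag : ∀ᵐ ω ∂P, IsCadlag (fun t => Z t ω)

/-- The Lévy measure `(A 1_{z > 0} + B 1_{z < 0}) |z| ^ (-(α + 1)) dz`. -/
noncomputable def stableLevyMeasure (α A B : ℝ) : Measure ℝ :=
  volume.withDensity fun z =>
    ENNReal.ofReal
      ((Set.indicator (Set.Ioi 0) (fun _ => A) z + Set.indicator (Set.Iio 0) (fun _ => B) z)
        * |z| ^ (-(α + 1)))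

/-- The Lévy-Khintchine exponent of the triplet `(0, ν, γ)` (no Gaussian part), with respect to the
truncation function `z 1_{|z| ≤ 1}`. -/
noncomputable def levyExponent (ν : Measure ℝ) (γ u : ℝ) : ℂ :=
  Complex.I * γ * u +
    ∫ z, (Complex.exp (Complex.I * u * z) - 1
      - Set.indicator (Set.Icc (-1 : ℝ) 1) (fun z : ℝ => Complex.I * u * z) z) ∂ν

/-- An `α`-stable Lévy process, `0 < α < 2`: a Lévy process with triplet `(0, ν, γ)` where
`ν(dz) = (A 1_{z > 0} + B 1_{z < 0}) |z| ^ (-(α + 1)) dz` for constants `A, B ≥ 0`, not both `0`. -/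
structure IsStableLevyProcess {Ω : Type*} [MeasurableSpace Ω] (α : ℝ) (Z : ℝ≥0 → Ω → ℝ)
    (P : Measure Ω) : Prop extends IsLevyProcess Z P where
  triplet : ∃ A B γ : ℝ, 0 ≤ A ∧ 0 ≤ B ∧ 0 < A + B ∧ ∀ (t : ℝ≥0) (u : ℝ),
    charFun (P.map (Z t)) u =
      Complex.exp ((t : ℝ) * levyExponent (stableLevyMeasure α A B) γ u)

/-- A subordinator: a Lévy process whose paths are (almost surely) nondecreasing. -/
structure IsSubordinator {Ω : Type*} [MeasurableSpace Ω] (ζ : ℝ≥0 → Ω → ℝ) (P : Measure Ω) :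
    Prop extends IsLevyProcess ζ P where
  monotone : ∀ᵐ ω ∂P, Monotone fun t => ζ t ω

/-- The time-changed process `X^{(a)}_t = t ^ κ exp(-κ ζ_{a + log t}) Z_{exp(ζ_{a + log t})}`,
meant for `t ≥ exp(-a)`. -/
noncomputable def timeChange {Ω : Type*} (κ : ℝ) (Z ζ : ℝ≥0 → Ω → ℝ) (a : ℝ) (t : ℝ≥0) (ω : Ω) :
    ℝ :=
  (t : ℝ) ^ κ * Real.exp (-κ * ζ (a + Real.log t).toNNReal ω)
    * Z (Real.exp (ζ (a + Real.log t).toNNReal ω)).toNNReal ω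

/-- `X` (on its own probability space) is the mimic of `Z` built from the subordinator `ζ`:
it starts at `0` and for every real `a` the processes `(X_t)_{t ≥ exp(-a)}` and
`(X^{(a)}_t)_{t ≥ exp(-a)}` have the same finite-dimensional distributions. -/
structure IsMimic {Ω Ω' : Type*} [MeasurableSpace Ω] [MeasurableSpace Ω'] (κ : ℝ)
    (Z ζ : ℝ≥0 → Ω → ℝ) (P : Measure Ω) (X : ℝ≥0 → Ω' → ℝ) (P' : Measure Ω') : Prop where
  measurable : ∀ t, Measurable (X t)
  zero : ∀ᵐ ω ∂P', X 0 ω = 0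
  identDistrib : ∀ (a : ℝ) (I : Finset ℝ≥0), (∀ t ∈ I, Real.exp (-a) ≤ (t : ℝ)) →
    IdentDistrib (fun ω => I.restrict (fun t => X t ω))
      (fun ω => I.restrict (fun t => timeChange κ Z ζ a t ω)) P' P

end StableMimic

/-! Everything reduces to the joint law of `(X_s, X_t)`. Take `a = -log s` and `u = log (t/s)`.
Since `ζ_0 = 0`, this pair has the law of `(s^κ Z_1, t^κ R^κ Z_{1+H})` with `R = exp(-ζ_u)` and `1 +
H = exp ζ_u`, where `H ≥ 0` is independent of `Z`. The martingale property makes `Z_1` centred,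
which removes the drift, so `Z_h` has the law of `h^κ Z_1` (`IsStableLevyProcess.map_eq`). With
independent stationary increments and an independent `H`, `Z_{1+H}` becomes `Z_1 + H^κ ξ` in law,
with `H`, `Z_1`, `ξ` independent (`map_randomTime`). As `RH = 1 - R`, this is the claimed formula,
in law (`IsMimic.map_pair`).

One extra uniform variable turns equality in law into almost sure equality: `exists_transfer` draws
`(R, ξ, X_s)` from its conditional law given the observed pair `(X_s, X_t)`. -/

namespace StableMimic

/-! ### From equality in law to almost sure equality. -/

/-- Transfer: if `Y` has the law of `G` under `Q`, then, given an independent uniform variable,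
`Y` can be completed to a variable `V` of law `Q` with `G V = Y` almost surely. -/
theorem exists_transfer {Ω' S E : Type*} [MeasurableSpace Ω'] [MeasurableSpace S]
    [StandardBorelSpace S] [Nonempty S] [MeasurableSpace E] [MeasurableEq E]
    (P' : Measure Ω') [IsProbabilityMeasure P'] (Q : Measure S) [IsProbabilityMeasure Q]
    {Y : Ω' → E} (hY : Measurable Y) {G : S → E} (hG : Measurable G)
    (hlaw : P'.map Y = Q.map G) :
    ∃ V : Ω' × unitInterval → S, Measurable V ∧
      (P'.prod (volume : Measure unitInterval)).map V = Q ∧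
      ∀ᵐ ω ∂(P'.prod (volume : Measure unitInterval)), G (V ω) = Y ω.1 := by
  -- For uniform `U`, `f y U` samples the conditional law under `Q` of a point given that `G` takes
  -- the value `y`.
  obtain ⟨f, hf, hfK⟩ :=
    (condDistrib (id : S → S) G Q).exists_measurable_map_eq_unitInterval
  have hV : Measurable fun p : Ω' × unitInterval => f (Y p.1) p.2 :=
    hf.comp ((hY.comp measurable_fst).prodMk measurable_snd)
  have hYV : Measurable fun p : Ω' × unitInterval => (Y p.1, f (Y p.1) p.2) :=
    (hY.comp measurable_fst).prodMk hV
  have hGid : Measurable fun x => (G x, x) := hG.prodMk measurable_id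
  have key : (P'.prod (volume : Measure unitInterval)).map (fun p => (Y p.1, f (Y p.1) p.2))
      = Q.map fun x => (G x, x) := by
    have h := compProd_map_condDistrib (μ := Q) (mβ := ‹MeasurableSpace E›)
      (X := G) (Y := (id : S → S)) aemeasurable_id
    simp only [id] at h
    rw [← h, ← hlaw]
    ext B hB
    rw [Measure.map_apply hYV hB, Measure.prod_apply (hYV hB), Measure.compProd_apply hB,
      lintegral_map (Kernel.measurable_kernel_prodMk_left hB) hY]
    refine lintegral_congr fun ω => ?_
    have := congrArg (fun m => m (Prod.mk (Y ω) ⁻¹' B)) (hfK (Y ω))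
    rw [Measure.map_apply (show Measurable (f (Y ω)) from hf.of_uncurry_left)
      (measurable_prodMk_left hB)] at this
    exact this
  refine ⟨_, hV, ?_, ?_⟩
  · have := congrArg (Measure.map Prod.snd) key
    rw [Measure.map_map measurable_snd hYV,
      Measure.map_map measurable_snd hGid] at this
    simpa [Function.comp_def] using this
  -- The equality holds surely for `(G x, x)`, and it depends only on the joint law, so `key`
  -- carries it over.
  · have hset : MeasurableSet {q : E × S | G q.2 = q.1} :=
      measurableSet_eq_fun (hG.comp measurable_snd) measurable_fst
    have : ∀ᵐ q ∂(Q.map fun x => (G x, x)), G q.2 = q.1 := by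
      rw [ae_map_iff hGid.aemeasurable hset]
      exact ae_of_all _ fun x => rfl
    rw [← key, ae_map_iff hYV.aemeasurable hset] at this
    exact this

/-! ### The stable Lévy measure and its exponent. -/

/-- The density of `stableLevyMeasure`. -/
noncomputable def stableDensity (α A B z : ℝ) : ℝ :=
  (Set.indicator (Set.Ioi 0) (fun _ => A) z + Set.indicator (Set.Iio 0) (fun _ => B) z)
    * |z| ^ (-(α + 1))

theorem measurable_stableDensity (α A B : ℝ) : Measurable (stableDensity α A B) := by
  unfold stableDensity
  have h1 : Measurable (Set.indicator (Set.Ioi (0 : ℝ)) (fun _ => A)) :=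
    measurable_const.indicator measurableSet_Ioi
  have h2 : Measurable (Set.indicator (Set.Iio (0 : ℝ)) (fun _ => B)) :=
    measurable_const.indicator measurableSet_Iio
  have h3 : Measurable fun z : ℝ => |z| ^ (-(α + 1)) := by fun_prop
  exact (h1.add h2).mul h3

theorem stableDensity_nonneg {A B : ℝ} (hA : 0 ≤ A) (hB : 0 ≤ B) (α z : ℝ) :
    0 ≤ stableDensity α A B z :=
  mul_nonneg (add_nonneg (Set.indicator_nonneg (fun _ _ => hA) z)
    (Set.indicator_nonneg (fun _ _ => hB) z)) (by positivity)

theorem stableDensity_le {A B : ℝ} (hA : 0 ≤ A) (hB : 0 ≤ B) (α z : ℝ) :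
    stableDensity α A B z ≤ (A + B) * |z| ^ (-(α + 1)) := by
  unfold stableDensity
  gcongr
  · exact Set.indicator_le_self' (fun _ _ => hA) z
  · exact Set.indicator_le_self' (fun _ _ => hB) z

theorem stableDensity_mul {c : ℝ} (hc : 0 < c) (α A B z : ℝ) :
    stableDensity α A B (c * z) = c ^ (-(α + 1)) * stableDensity α A B z := by
  unfold stableDensity
  rw [abs_mul, abs_of_pos hc, Real.mul_rpow hc.le (abs_nonneg z)]
  have h1 : Set.indicator (Set.Ioi (0 : ℝ)) (fun _ => A) (c * z)
      = Set.indicator (Set.Ioi (0 : ℝ)) (fun _ => A) z := by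
    simp [Set.indicator_apply, hc]
  have h2 : Set.indicator (Set.Iio (0 : ℝ)) (fun _ => B) (c * z)
      = Set.indicator (Set.Iio (0 : ℝ)) (fun _ => B) z := by
    simp only [Set.indicator_apply, Set.mem_Iio, mul_neg_iff, hc, hc.not_gt, true_and, false_and,
      or_false]
  rw [h1, h2]
  ring

theorem integral_stableLevyMeasure {A B : ℝ} (hA : 0 ≤ A) (hB : 0 ≤ B) (α : ℝ) (g : ℝ → ℂ) :
    ∫ z, g z ∂(stableLevyMeasure α A B) = ∫ z, stableDensity α A B z • g z := by
  have := integral_withDensity_eq_integral_toReal_smul (μ := (volume : Measure ℝ))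
    (measurable_stableDensity α A B).ennreal_ofReal (ae_of_all _ fun _ => ENNReal.ofReal_lt_top) g
  simp only [ENNReal.toReal_ofReal (stableDensity_nonneg hA hB α _)] at this
  exact this

theorem integrable_stableLevyMeasure_iff {A B : ℝ} (hA : 0 ≤ A) (hB : 0 ≤ B) (α : ℝ)
    (g : ℝ → ℂ) :
    Integrable g (stableLevyMeasure α A B) ↔ Integrable fun z => stableDensity α A B z • g z := by
  have := integrable_withDensity_iff_integrable_smul' (μ := (volume : Measure ℝ))
    (measurable_stableDensity α A B).ennreal_ofReal (ae_of_all _ fun _ => ENNReal.ofReal_lt_top)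
    (g := g)
  simp only [ENNReal.toReal_ofReal (stableDensity_nonneg hA hB α _)] at this
  exact this

/-- For positive `z` the integrand is `z^(1-α)` near `0`, integrable as `α < 2`, and `z^(-α)` near
infinity, integrable as `α > 1`. -/
theorem integrable_abs_rpow_mul_min {α : ℝ} (hα₁ : 1 < α) (hα₂ : α < 2) :
    Integrable fun z : ℝ => |z| ^ (-(α + 1)) * min |z| (z ^ 2) := by
  set f : ℝ → ℝ := fun z => |z| ^ (-(α + 1)) * min |z| (z ^ 2) with hf
  have heven : ∀ z, f (-z) = f z := fun z => by simp [hf]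
  have h1 : IntegrableOn f (Set.Ioc 0 1) := by
    have : IntegrableOn (fun z : ℝ => z ^ (1 - α)) (Set.Ioc 0 1) :=
      (intervalIntegrable_iff_integrableOn_Ioc_of_le zero_le_one).1
        (intervalIntegral.intervalIntegrable_rpow' (by linarith))
    refine this.congr_fun (fun z hz => ?_) measurableSet_Ioc
    have hz0 : 0 < z := hz.1
    have : min z (z ^ 2) = z ^ (2 : ℝ) := by
      rw [Real.rpow_two, min_eq_right]
      nlinarith [hz.2]
    simp only [hf, abs_of_pos hz0, this, ← Real.rpow_add hz0]
    congr 1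
    ring
  have h2 : IntegrableOn f (Set.Ioi 1) := by
    have : IntegrableOn (fun z : ℝ => z ^ (-α)) (Set.Ioi 1) :=
      integrableOn_Ioi_rpow_of_lt (by linarith) one_pos
    refine this.congr_fun (fun z hz => ?_) measurableSet_Ioi
    have hz1 : 1 < z := hz
    have hz0 : 0 < z := one_pos.trans hz1
    have : min z (z ^ 2) = z ^ (1 : ℝ) := by
      rw [Real.rpow_one, min_eq_left]
      nlinarith
    simp only [hf, abs_of_pos hz0, this, ← Real.rpow_add hz0]
    congr 1
    ring
  have h3 : IntegrableOn f (Set.Ioi 0) := by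
    rw [← Set.Ioc_union_Ioi_eq_Ioi zero_le_one]
    exact h1.union h2
  have h4 : IntegrableOn f (Set.Iic 0) := by
    have := h3.comp_neg
    simp only [heven, Set.neg_Ioi, neg_zero] at this
    exact (integrableOn_Iic_iff_integrableOn_Iio (by simp)).2 this
  rw [← integrableOn_univ, ← Set.Iic_union_Ioi (a := (0 : ℝ))]
  exact h4.union h3

theorem integrable_stableLevyMeasure_of_norm_le {α A B : ℝ} (hα₁ : 1 < α) (hα₂ : α < 2)
    (hA : 0 ≤ A) (hB : 0 ≤ B) {g : ℝ → ℂ} (hg : Measurable g) {C : ℝ}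
    (hC : ∀ z, ‖g z‖ ≤ C * min |z| (z ^ 2)) : Integrable g (stableLevyMeasure α A B) := by
  rw [integrable_stableLevyMeasure_iff hA hB]
  refine ((integrable_abs_rpow_mul_min hα₁ hα₂).const_mul ((A + B) * C)).mono'
    ((measurable_stableDensity α A B).smul hg).aestronglyMeasurable (ae_of_all _ fun z => ?_)
  rw [norm_smul, Real.norm_of_nonneg (stableDensity_nonneg hA hB α z)]
  calc stableDensity α A B z * ‖g z‖
      ≤ ((A + B) * |z| ^ (-(α + 1))) * (C * min |z| (z ^ 2)) :=
        mul_le_mul (stableDensity_le hA hB α z) (hC z) (norm_nonneg _) (by positivity)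
    _ = _ := by ring

theorem norm_exp_sub_one_sub_le (u z : ℝ) :
    ‖Complex.exp (Complex.I * u * z) - 1 - Complex.I * u * z‖
      ≤ (2 * |u| + 2 * u ^ 2) * min |z| (z ^ 2) := by
  have hn : ‖Complex.I * u * z‖ = |u| * |z| := by simp
  have h1 : ‖Complex.exp (Complex.I * u * z) - 1 - Complex.I * u * z‖ ≤ 2 * (|u| * |z|) := by
    refine (norm_sub_le _ _).trans ?_
    have := Real.norm_exp_I_mul_ofReal_sub_one_le (x := u * z)
    rw [Complex.ofReal_mul, ← mul_assoc, Real.norm_eq_abs, abs_mul] at this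
    rw [hn]
    linarith
  have h2 : ‖Complex.exp (Complex.I * u * z) - 1 - Complex.I * u * z‖
      ≤ 2 * (|u| * |z|) ^ 2 := by
    rcases le_total (|u| * |z|) 1 with h | h
    · have := Complex.norm_exp_sub_one_sub_id_le (x := Complex.I * u * z) (by rwa [hn])
      rw [hn] at this
      nlinarith [sq_nonneg (|u| * |z|)]
    · nlinarith
  rw [mul_pow, sq_abs, sq_abs] at h2
  rcases min_cases |z| (z ^ 2) with ⟨h, -⟩ | ⟨h, -⟩ <;> rw [h]
  · nlinarith [mul_nonneg (sq_nonneg u) (abs_nonneg z)]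
  · nlinarith [mul_nonneg (abs_nonneg u) (sq_nonneg z)]

/-- The fully compensated exponent `∫ (exp (i u z) - 1 - i u z) ν(dz)` of a stable law. -/
noncomputable def compensatedExponent (α A B u : ℝ) : ℂ :=
  ∫ z, (Complex.exp (Complex.I * u * z) - 1 - Complex.I * u * z) ∂(stableLevyMeasure α A B)

/-- Substituting `c z` for `z` in the integral leaves the factor `c^α`. Full compensation is what
makes this work: the truncation at `|z| ≤ 1` is not scale invariant. -/
theorem compensatedExponent_mul {A B : ℝ} (hA : 0 ≤ A) (hB : 0 ≤ B) (α : ℝ) {c : ℝ}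
    (hc : 0 < c) (u : ℝ) :
    compensatedExponent α A B (c * u) = ((c ^ α : ℝ) : ℂ) * compensatedExponent α A B u := by
  unfold compensatedExponent
  rw [integral_stableLevyMeasure hA hB, integral_stableLevyMeasure hA hB]
  have h := Measure.integral_comp_mul_left (fun z : ℝ => stableDensity α A B z •
    (Complex.exp (Complex.I * u * z) - 1 - Complex.I * u * z)) c
  simp only [stableDensity_mul hc, abs_of_pos (inv_pos.2 hc)] at h
  rw [eq_inv_smul_iff₀ hc.ne'] at h
  rw [← h, ← Complex.real_smul, ← integral_smul, ← integral_smul]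
  refine integral_congr_ae (ae_of_all _ fun z => ?_)
  have e : c ^ α * (c * (c ^ (-(α + 1)) * stableDensity α A B z)) = stableDensity α A B z := by
    have : c ^ α * c * c ^ (-(α + 1)) = 1 := by
      rw [← Real.rpow_add_one hc.ne', ← Real.rpow_add hc]
      simp
    linear_combination stableDensity α A B z * this
  simp only [smul_smul, e, Complex.ofReal_mul]
  congr 1
  ring_nf

/-- Since `α > 1`, `z` is integrable over `|z| > 1`, so removing the truncation only changes the
drift. -/
theorem levyExponent_eq {α A B : ℝ} (hα₁ : 1 < α) (hα₂ : α < 2) (hA : 0 ≤ A) (hB : 0 ≤ B)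
    (γ : ℝ) : ∃ b : ℂ, ∀ u : ℝ, levyExponent (stableLevyMeasure α A B) γ u =
      Complex.I * b * u + compensatedExponent α A B u := by
  set ν := stableLevyMeasure α A B with hν
  let f : ℝ → ℂ := Set.indicator (Set.Icc (-1 : ℝ) 1)ᶜ fun z => (z : ℂ)
  refine ⟨γ + ∫ z, f z ∂ν, fun u => ?_⟩
  have hf : Integrable f ν := by
    refine integrable_stableLevyMeasure_of_norm_le hα₁ hα₂ hA hB (C := 1)
      (Complex.measurable_ofReal.indicator measurableSet_Icc.compl) fun z => ?_
    simp only [f, Set.indicator_apply]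
    split_ifs with h
    · have : 1 < |z| := by
        rw [← not_le, abs_le]
        exact h
      have h2 : |z| ≤ z ^ 2 := by rw [← sq_abs]; nlinarith
      simp [min_eq_left h2]
    · simp only [norm_zero]
      positivity
  have hc : Integrable (fun z : ℝ =>
      Complex.exp (Complex.I * u * z) - 1 - Complex.I * u * z) ν :=
    integrable_stableLevyMeasure_of_norm_le hα₁ hα₂ hA hB (by fun_prop)
      (norm_exp_sub_one_sub_le u)
  have hsum : ∀ z : ℝ, Complex.exp (Complex.I * u * z) - 1
      - Set.indicator (Set.Icc (-1 : ℝ) 1) (fun z : ℝ => Complex.I * u * z) z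
      = (Complex.exp (Complex.I * u * z) - 1 - Complex.I * u * z) + Complex.I * u * f z := by
    intro z
    by_cases h : z ∈ Set.Icc (-1 : ℝ) 1
    · simp [f, h]
    · simp only [f, Set.indicator_of_notMem h, Set.indicator_of_mem (Set.mem_compl h)]
      ring
  unfold levyExponent compensatedExponent
  simp only [hsum]
  rw [integral_add hc (hf.const_mul _), integral_const_mul]
  ring

theorem compensatedExponent_zero (α A B : ℝ) : compensatedExponent α A B 0 = 0 := by
  simp [compensatedExponent]

/-! ### Vanishing drift and self-similarity. -/

theorem hasDerivAt_charFun_zero {μ : Measure ℝ} [IsFiniteMeasure μ] (hint : Integrable id μ)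
    (hmean : ∫ x, x ∂μ = 0) : HasDerivAt (charFun μ) 0 0 := by
  have hm : MemLp id ((1 : ℕ) : ENNReal) μ := by simpa using memLp_one_iff_integrable.2 hint
  have h0 := iteratedDeriv_charFun_zero hm
  simp only [iteratedDeriv_one, pow_one, hmean, Complex.ofReal_zero, mul_zero] at h0
  have := ((contDiff_charFun hm).differentiable (by simp) 0).hasDerivAt
  rwa [h0] at this

/-- A centred exponent of index `α > 1` has no drift. -/
theorem drift_eq_zero {α A B : ℝ} (hα₁ : 1 < α) (hA : 0 ≤ A) (hB : 0 ≤ B) {χ : ℝ → ℂ} {b : ℂ}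
    (hχ : HasDerivAt χ 0 0)
    (h : ∀ u : ℝ, χ u = Complex.exp (Complex.I * b * u + compensatedExponent α A B u)) :
    b = 0 := by
  have hα0 : α ≠ 0 := by linarith
  -- As `α > 1`, `u^α` is `o(u)` at `0`, so only the drift contributes to the derivative.
  have hpow : HasDerivAt (fun u : ℝ => ((u ^ α : ℝ) : ℂ)) 0 0 := by
    have := (Real.hasDerivAt_rpow_const (x := 0) (p := α) (Or.inr hα₁.le)).ofReal_comp
    rwa [Real.zero_rpow (by linarith), mul_zero, Complex.ofReal_zero] at this
  have h1 : HasDerivAt (fun u : ℝ => Complex.I * b * u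
      + ((u ^ α : ℝ) : ℂ) * compensatedExponent α A B 1) (Complex.I * b) 0 := by
    have := ((Complex.ofRealCLM.hasDerivAt (x := (0 : ℝ))).const_mul (Complex.I * b)).fun_add
      (hpow.mul_const (compensatedExponent α A B 1))
    simpa using this
  have h2 := h1.cexp
  simp only [Complex.ofReal_zero, mul_zero, Real.zero_rpow hα0, zero_mul, add_zero,
    Complex.exp_zero, one_mul] at h2
  -- Homogeneity is known only for positive scalings, hence the one-sided derivative.
  have h3 : HasDerivWithinAt χ (Complex.I * b) (Set.Ici 0) 0 := by
    refine h2.hasDerivWithinAt.congr_of_mem (fun u hu => ?_) (Set.self_mem_Ici)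
    rw [h u]
    rcases (Set.mem_Ici.1 hu).eq_or_lt with h0 | h0
    · simp [← h0, compensatedExponent_zero, Real.zero_rpow hα0]
    · rw [← compensatedExponent_mul hA hB α h0 1, mul_one]
  have := (uniqueDiffWithinAt_Ici (0 : ℝ)).eq_deriv _ h3 hχ.hasDerivWithinAt
  simpa using this

/-- Without drift the exponent is homogeneous of degree `α`, so multiplying it by `t` amounts to
replacing `u` by `t^(1/α) u`. -/
theorem IsStableLevyProcess.map_eq {Ω : Type*} [MeasurableSpace Ω] {P : Measure Ω}
    [IsProbabilityMeasure P] {α : ℝ} (hα₁ : 1 < α) (hα₂ : α < 2) {Z : ℝ≥0 → Ω → ℝ}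
    (hZ : IsStableLevyProcess α Z P) (hint : Integrable (Z 1) P) (hmean : ∫ ω, Z 1 ω ∂P = 0)
    (t : ℝ≥0) :
    P.map (Z t) = (P.map (Z 1)).map (fun x => (t : ℝ) ^ (1 / α) * x) := by
  obtain ⟨A, B, γ, hA, hB, -, h⟩ := hZ.triplet
  obtain ⟨b, hb⟩ := levyExponent_eq hα₁ hα₂ hA hB γ
  have hα0 : α ≠ 0 := by linarith
  have := Measure.isProbabilityMeasure_map (μ := P) (hZ.measurable t).aemeasurable
  have := Measure.isProbabilityMeasure_map (μ := P) (hZ.measurable 1).aemeasurable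
  have hb0 : b = 0 := by
    refine drift_eq_zero hα₁ hA hB (hasDerivAt_charFun_zero (μ := P.map (Z 1)) ?_ ?_)
      fun u => ?_
    · rwa [integrable_map_measure (by fun_prop) (hZ.measurable 1).aemeasurable]
    · rwa [integral_map (hZ.measurable 1).aemeasurable (by fun_prop)]
    · rw [h 1 u, hb u]
      simp
  have hm : Measurable fun x : ℝ => (t : ℝ) ^ (1 / α) * x := by fun_prop
  have := Measure.isProbabilityMeasure_map (μ := P.map (Z 1)) hm.aemeasurable
  refine Measure.ext_of_charFun (funext fun u => ?_)
  rw [charFun_map_mul, h t u, h 1, hb, hb, hb0]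
  rcases eq_or_ne t 0 with rfl | ht
  · simp [Real.zero_rpow (inv_ne_zero hα0), compensatedExponent_zero]
  · have ht0 : (0 : ℝ) < t := by positivity
    rw [compensatedExponent_mul hA hB α (Real.rpow_pos_of_pos ht0 _), ← Real.rpow_mul ht0.le]
    simp [hα0]

/-! ### Evaluation at an independent random time. -/

/-- The point of the grid of mesh `1 / (n + 1)` strictly to the right of `h`. -/
noncomputable def gridAbove (n : ℕ) (h : ℝ≥0) : ℝ≥0 :=
  ((⌊((n : ℝ≥0) + 1) * h⌋₊ : ℝ≥0) + 1) / ((n : ℝ≥0) + 1)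

theorem measurable_gridAbove (n : ℕ) : Measurable (gridAbove n) := by
  unfold gridAbove
  fun_prop

theorem lt_gridAbove (n : ℕ) (h : ℝ≥0) : h < gridAbove n h := by
  rw [gridAbove, lt_div_iff₀ (by positivity), mul_comm]
  exact Nat.lt_floor_add_one _

theorem gridAbove_le (n : ℕ) (h : ℝ≥0) : gridAbove n h ≤ h + 1 / ((n : ℝ≥0) + 1) := by
  have hn : (0 : ℝ≥0) < (n : ℝ≥0) + 1 := by positivity
  rw [gridAbove, div_le_iff₀ hn, add_mul h, one_div, inv_mul_cancel₀ hn.ne', mul_comm h]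
  gcongr
  exact Nat.floor_le zero_le

theorem tendsto_gridAbove (h : ℝ≥0) :
    Tendsto (fun n => gridAbove n h) atTop (𝓝[>] h) := by
  refine tendsto_nhdsWithin_iff.2 ⟨?_, Eventually.of_forall fun n => lt_gridAbove n h⟩
  refine tendsto_of_tendsto_of_tendsto_of_le_of_le tendsto_const_nhds ?_
    (fun n => (lt_gridAbove n h).le) (fun n => gridAbove_le n h)
  have : Tendsto (fun n : ℕ => h + 1 / ((n : ℝ≥0) + 1)) atTop (𝓝 (h + 0)) :=
    tendsto_const_nhds.add tendsto_one_div_add_atTop_nhds_zero_nat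
  simpa using this

/-- Evaluating an arbitrary path at a varying time need not be jointly measurable for the product
σ-algebra; with countably many times it is. -/
theorem measurable_path_countable {β E : Type*} [MeasurableSpace β] [MeasurableSpace E]
    {φ : ℝ≥0 → ℝ → ℝ → β} (hφ : Measurable fun q : ℝ≥0 × ℝ × ℝ => φ q.1 q.2.1 q.2.2)
    (g : ℕ → ℝ≥0) {N : E → ℕ} (hN : Measurable N) :
    Measurable fun q : (ℝ≥0 → ℝ) × E => φ (g (N q.2)) (q.1 1) (q.1 (1 + g (N q.2))) := by
  have h1 : Measurable fun q : (ℝ≥0 → ℝ) × ℕ => φ (g q.2) (q.1 1) (q.1 (1 + g q.2)) := by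
    refine measurable_from_prod_countable_left fun k => ?_
    have h : Measurable fun p : ℝ≥0 → ℝ => (g k, p 1, p (1 + g k)) :=
      measurable_const.prodMk ((measurable_pi_apply _).prodMk (measurable_pi_apply _))
    exact hφ.comp h
  have h2 : Measurable fun q : (ℝ≥0 → ℝ) × E => (q.1, N q.2) :=
    measurable_fst.prodMk (hN.comp measurable_snd)
  exact h1.comp h2

theorem measurable_path_gridAbove (n : ℕ) {β : Type*} [MeasurableSpace β]
    {φ : ℝ≥0 → ℝ → ℝ → β} (hφ : Measurable fun q : ℝ≥0 × ℝ × ℝ => φ q.1 q.2.1 q.2.2) :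
    Measurable fun q : (ℝ≥0 → ℝ) × ℝ≥0 =>
      φ (gridAbove n q.2) (q.1 1) (q.1 (1 + gridAbove n q.2)) := by
  have hN : Measurable fun h : ℝ≥0 => ⌊((n : ℝ≥0) + 1) * h⌋₊ :=
    Nat.measurable_floor.comp (measurable_id.const_mul _)
  have := measurable_path_countable hφ (fun k => ((k : ℝ≥0) + 1) / ((n : ℝ≥0) + 1)) hN
  simpa only [gridAbove] using this

variable {Ω : Type*} [MeasurableSpace Ω] {P : Measure Ω}

/-- The grid point must be strictly to the right, as `IsCadlag` gives continuity along `Set.Ioi`. -/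
theorem tendsto_gridAbove_path {Z : ℝ≥0 → Ω → ℝ} (hcad : ∀ᵐ ω ∂P, IsCadlag fun t => Z t ω)
    (H : Ω → ℝ≥0) :
    ∀ᵐ ω ∂P, Tendsto (fun n => Z (1 + gridAbove n (H ω)) ω) atTop (𝓝 (Z (1 + H ω) ω)) := by
  filter_upwards [hcad] with ω hω
  refine (hω (1 + H ω)).1.tendsto.comp (tendsto_nhdsWithin_iff.2 ⟨?_, ?_⟩)
  · exact tendsto_const_nhds.add ((tendsto_gridAbove (H ω)).mono_right nhdsWithin_le_nhds)
  · exact Eventually.of_forall fun n => add_lt_add_right (lt_gridAbove n (H ω)) 1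

theorem aemeasurable_randomTime {Z : ℝ≥0 → Ω → ℝ} (hZ : ∀ t, Measurable (Z t))
    (hcad : ∀ᵐ ω ∂P, IsCadlag fun t => Z t ω) {H : Ω → ℝ≥0} (hH : Measurable H) :
    AEMeasurable (fun ω => Z (1 + H ω) ω) P := by
  refine aemeasurable_of_tendsto_metrizable_ae atTop (fun n => ?_) (tendsto_gridAbove_path hcad H)
  have h1 := measurable_path_gridAbove n (φ := fun _ _ z => z) (by fun_prop)
  have h2 : Measurable fun ω => ((fun t => Z t ω), H ω) := (measurable_pi_lambda _ hZ).prodMk hH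
  exact (h1.comp h2).aemeasurable

/-- Independence and Fubini freeze `H` at a constant, where `hlaw` applies; the grid makes the
integrand measurable. -/
theorem integral_path_gridAbove [IsProbabilityMeasure P] {Z : ℝ≥0 → Ω → ℝ} (hZ : ∀ t, Measurable (Z t)) {H : Ω → ℝ≥0}
    (hH : Measurable H) (hind : IndepFun (fun ω t => Z t ω) H P) {κ : ℝ} {μ : Measure ℝ}
    [IsProbabilityMeasure μ]
    (hlaw : ∀ h : ℝ≥0, P.map (fun ω => (Z 1 ω, Z (1 + h) ω)) =
      (μ.prod μ).map fun q => (q.1, q.1 + (h : ℝ) ^ κ * q.2))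
    (φ : BoundedContinuousFunction (ℝ≥0 × ℝ × ℝ) ℝ) (n : ℕ) :
    ∫ ω, φ (gridAbove n (H ω), Z 1 ω, Z (1 + gridAbove n (H ω)) ω) ∂P =
      ∫ q, φ (gridAbove n q.1, q.2.1, q.2.1 + (gridAbove n q.1 : ℝ) ^ κ * q.2.2)
        ∂((P.map H).prod (μ.prod μ)) := by
  have hpath : Measurable fun ω t => Z t ω := measurable_pi_lambda _ hZ
  have := Measure.isProbabilityMeasure_map (μ := P) hH.aemeasurable
  have := Measure.isProbabilityMeasure_map (μ := P) hpath.aemeasurable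
  have hφ := φ.continuous.measurable
  have hΨ := measurable_path_gridAbove n (φ := fun a b c => φ (a, b, c)) hφ
  have hprod := (indepFun_iff_map_prod_eq_prod_map_map hpath.aemeasurable hH.aemeasurable).1 hind
  have e1 := integral_map (μ := P) (hpath.prodMk hH).aemeasurable hΨ.aestronglyMeasurable
  simp only at e1
  rw [← e1, hprod, integral_prod_symm, integral_prod]
  · refine integral_congr_ae (ae_of_all _ fun h => ?_)
    set t := gridAbove n h with ht
    have e2 := integral_map (μ := P) hpath.aemeasurable
      (f := fun p : ℝ≥0 → ℝ => φ (t, p 1, p (1 + t)))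
      (hφ.comp (measurable_const.prodMk
        ((measurable_pi_apply 1).prodMk (measurable_pi_apply (1 + t))))).aestronglyMeasurable
    have e3 := integral_map (μ := P) ((hZ 1).prodMk (hZ (1 + t))).aemeasurable
      (f := fun p : ℝ × ℝ => φ (t, p))
      (hφ.comp (measurable_const.prodMk measurable_id)).aestronglyMeasurable
    have hm : Measurable fun q : ℝ × ℝ => (q.1, q.1 + (t : ℝ) ^ κ * q.2) := by fun_prop
    have e4 := integral_map (μ := μ.prod μ) hm.aemeasurable
      (f := fun p : ℝ × ℝ => φ (t, p))
      (hφ.comp (measurable_const.prodMk measurable_id)).aestronglyMeasurable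
    simp only at e2 e3 e4 ⊢
    rw [e2, ← e3, hlaw t, e4]
  · refine Integrable.of_bound (C := ‖φ‖) (Measurable.aestronglyMeasurable ?_)
      (ae_of_all _ fun _ => φ.norm_coe_le_norm _)
    have := measurable_gridAbove n
    fun_prop
  · exact Integrable.of_bound (C := ‖φ‖) hΨ.aestronglyMeasurable
      (ae_of_all _ fun _ => φ.norm_coe_le_norm _)

/-- The joint law of a process at times `1` and `1 + H`, for an independent random time `H`. -/
theorem map_randomTime [IsProbabilityMeasure P] {Z : ℝ≥0 → Ω → ℝ} (hZ : ∀ t, Measurable (Z t))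
    (hcad : ∀ᵐ ω ∂P, IsCadlag fun t => Z t ω) {H : Ω → ℝ≥0}
    (hH : Measurable H) (hind : IndepFun (fun ω t => Z t ω) H P) {κ : ℝ} (hκ : 0 < κ)
    {μ : Measure ℝ} [IsProbabilityMeasure μ]
    (hlaw : ∀ h : ℝ≥0, P.map (fun ω => (Z 1 ω, Z (1 + h) ω)) =
      (μ.prod μ).map fun q => (q.1, q.1 + (h : ℝ) ^ κ * q.2)) :
    P.map (fun ω => (H ω, Z 1 ω, Z (1 + H ω) ω)) =
      ((P.map H).prod (μ.prod μ)).map fun q => (q.1, q.2.1, q.2.1 + (q.1 : ℝ) ^ κ * q.2.2) := by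
  have hm1 : AEMeasurable (fun ω => (H ω, Z 1 ω, Z (1 + H ω) ω)) P :=
    hH.aemeasurable.prodMk ((hZ 1).aemeasurable.prodMk (aemeasurable_randomTime hZ hcad hH))
  have hm2 : Measurable fun q : ℝ≥0 × ℝ × ℝ =>
    (q.1, q.2.1, q.2.1 + (q.1 : ℝ) ^ κ * q.2.2) := by fun_prop
  have := Measure.isProbabilityMeasure_map (μ := P) hH.aemeasurable
  have := Measure.isProbabilityMeasure_map hm1
  have := Measure.isProbabilityMeasure_map (μ := (P.map H).prod (μ.prod μ)) hm2.aemeasurable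
  -- Bounded continuous test functions let the grid identity pass to the limit on both sides by
  -- dominated convergence.
  refine ext_of_forall_integral_eq_of_IsFiniteMeasure fun φ => ?_
  have hφ := φ.continuous.measurable
  rw [integral_map hm1 hφ.aestronglyMeasurable, integral_map hm2.aemeasurable
    hφ.aestronglyMeasurable]
  have hgrid (h : ℝ≥0) : Tendsto (fun n => gridAbove n h) atTop (𝓝 h) :=
    (tendsto_gridAbove h).mono_right nhdsWithin_le_nhds
  have l1 : Tendsto (fun n => ∫ ω, φ (gridAbove n (H ω), Z 1 ω, Z (1 + gridAbove n (H ω)) ω) ∂P)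
      atTop (𝓝 (∫ ω, φ (H ω, Z 1 ω, Z (1 + H ω) ω) ∂P)) := by
    refine tendsto_integral_of_dominated_convergence (fun _ => ‖φ‖) (fun n => ?_)
      (integrable_const _) (fun n => ae_of_all _ fun _ => φ.norm_coe_le_norm _) ?_
    · exact ((measurable_path_gridAbove n (φ := fun a b c => φ (a, b, c)) hφ).comp
        ((measurable_pi_lambda _ hZ).prodMk hH)).aestronglyMeasurable
    · filter_upwards [tendsto_gridAbove_path hcad H] with ω hω
      exact (φ.continuous.tendsto _).comp
        ((hgrid (H ω)).prodMk_nhds (tendsto_const_nhds.prodMk_nhds hω))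
  have l2 : Tendsto (fun n => ∫ q, φ (gridAbove n q.1, q.2.1,
        q.2.1 + (gridAbove n q.1 : ℝ) ^ κ * q.2.2) ∂((P.map H).prod (μ.prod μ)))
      atTop (𝓝 (∫ q, φ (q.1, q.2.1, q.2.1 + (q.1 : ℝ) ^ κ * q.2.2)
        ∂((P.map H).prod (μ.prod μ)))) := by
    refine tendsto_integral_of_dominated_convergence (fun _ => ‖φ‖) (fun n => ?_)
      (integrable_const _) (fun n => ae_of_all _ fun _ => φ.norm_coe_le_norm _)
      (ae_of_all _ fun q => ?_)
    · have := measurable_gridAbove n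
      exact Measurable.aestronglyMeasurable (by fun_prop)
    -- `κ > 0` gives continuity of the power even at `0`.
    · have hpow : Tendsto (fun n => (gridAbove n q.1 : ℝ) ^ κ) atTop (𝓝 ((q.1 : ℝ) ^ κ)) :=
        (NNReal.tendsto_coe.2 (hgrid q.1)).rpow_const (Or.inr hκ.le)
      exact (φ.continuous.tendsto _).comp ((hgrid q.1).prodMk_nhds
        (tendsto_const_nhds.prodMk_nhds (tendsto_const_nhds.add (hpow.mul_const _))))
  simp only [integral_path_gridAbove hZ hH hind hlaw φ] at l1
  exact tendsto_nhds_unique l1 l2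

/-! ### Laws of the processes at two times. -/

theorem integral_eq_zero_of_martingale [IsProbabilityMeasure P] {Z : ℝ≥0 → Ω → ℝ} {ℱ : Filtration ℝ≥0 ‹MeasurableSpace Ω›}
    (h : Martingale Z ℱ P) (h0 : ∀ᵐ ω ∂P, Z 0 ω = 0) (t : ℝ≥0) : ∫ ω, Z t ω ∂P = 0 := by
  have h1 := h.setIntegral_eq (zero_le : 0 ≤ t) MeasurableSet.univ
  rw [setIntegral_univ, setIntegral_univ] at h1
  rw [← h1, integral_congr_ae (g := fun _ => 0) h0, integral_zero]

/-- The joint law at two times of a self-similar Lévy process. -/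
theorem IsLevyProcess.map_pair [IsProbabilityMeasure P] {Z : ℝ≥0 → Ω → ℝ} (hZ : IsLevyProcess Z P) {κ : ℝ} (h : ℝ≥0)
    (hself : P.map (Z h) = (P.map (Z 1)).map (fun x => (h : ℝ) ^ κ * x)) :
    P.map (fun ω => (Z 1 ω, Z (1 + h) ω)) =
      ((P.map (Z 1)).prod (P.map (Z 1))).map fun q => (q.1, q.1 + (h : ℝ) ^ κ * q.2) := by
  have hm := hZ.measurable
  have hD : Measurable fun ω => Z (1 + h) ω - Z 1 ω := (hm _).sub (hm _)
  have := Measure.isProbabilityMeasure_map (μ := P) (hm 1).aemeasurable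
  have hind : IndepFun (Z 1) (fun ω => Z (1 + h) ω - Z 1 ω) P := by
    refine (hZ.indepIncrements.indepFun_sub_sub zero_le
      (le_add_of_nonneg_right zero_le)).congr ?_ (ae_of_all _ fun ω => rfl)
    filter_upwards [hZ.zero] with ω hω
    simp [hω]
  have hlaw := (indepFun_iff_map_prod_eq_prod_map_map (hm 1).aemeasurable hD.aemeasurable).1 hind
  have hmul : Measurable fun x : ℝ => (h : ℝ) ^ κ * x := by fun_prop
  rw [(hZ.stationary 1 h).map_eq, hself] at hlaw
  have hid := Measure.map_prod_map (P.map (Z 1)) (P.map (Z 1)) measurable_id hmul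
  rw [Measure.map_id] at hid
  rw [hid] at hlaw
  have hadd : Measurable fun q : ℝ × ℝ => (q.1, q.1 + q.2) := by fun_prop
  have := congrArg (Measure.map fun q : ℝ × ℝ => (q.1, q.1 + q.2)) hlaw
  rw [Measure.map_map hadd ((hm 1).prodMk hD),
    Measure.map_map hadd (measurable_id.prodMap hmul)] at this
  simpa [Function.comp_def] using this

theorem IsSubordinator.nonneg {ζ : ℝ≥0 → Ω → ℝ} (hζ : IsSubordinator ζ P) (u : ℝ≥0) :
    ∀ᵐ ω ∂P, 0 ≤ ζ u ω := by
  filter_upwards [hζ.zero, hζ.monotone] with ω h0 hmono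
  rw [← h0]
  exact hmono zero_le

theorem IsMimic.identDistrib_pair {Ω' : Type*} [MeasurableSpace Ω'] {P' : Measure Ω'} {κ : ℝ}
    {Z ζ : ℝ≥0 → Ω → ℝ} {X : ℝ≥0 → Ω' → ℝ} (hX : IsMimic κ Z ζ P X P') {a : ℝ} {s t : ℝ≥0}
    (hs : Real.exp (-a) ≤ s) (ht : Real.exp (-a) ≤ t) :
    IdentDistrib (fun ω => (X s ω, X t ω))
      (fun ω => (timeChange κ Z ζ a s ω, timeChange κ Z ζ a t ω)) P' P := by
  classical
  have h := hX.identDistrib a {s, t} (by simp [hs, ht])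
  have hu : Measurable fun x : ({s, t} : Finset ℝ≥0) → ℝ =>
      (x ⟨s, by simp⟩, x ⟨t, by simp⟩) := by fun_prop
  exact h.comp hu

/-- The overshoot `exp ζ_u - 1` of the time change. -/
noncomputable def overshoot {Ω : Type*} (ζ : ℝ≥0 → Ω → ℝ) (u : ℝ≥0) (ω : Ω) : ℝ≥0 :=
  (Real.exp (ζ u ω) - 1).toNNReal

theorem one_add_overshoot {Ω : Type*} {ζ : ℝ≥0 → Ω → ℝ} {u : ℝ≥0} {ω : Ω} (h : 0 ≤ ζ u ω) :
    1 + overshoot ζ u ω = (Real.exp (ζ u ω)).toNNReal := by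
  have h1 : 0 ≤ Real.exp (ζ u ω) - 1 := sub_nonneg.2 (Real.one_le_exp h)
  rw [overshoot, ← Real.toNNReal_one, ← Real.toNNReal_add zero_le_one h1]
  congr 1
  ring

theorem inv_one_add_overshoot {Ω : Type*} {ζ : ℝ≥0 → Ω → ℝ} {u : ℝ≥0} {ω : Ω} (h : 0 ≤ ζ u ω) :
    (1 + (overshoot ζ u ω : ℝ))⁻¹ = Real.exp (-ζ u ω) := by
  have := congrArg NNReal.toReal (one_add_overshoot h)
  rw [NNReal.coe_add, NNReal.coe_one, Real.coe_toNNReal _ (Real.exp_pos _).le] at this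
  rw [this, Real.exp_neg]

/-- The right-hand side of the representation, paired with `X_s`, as a function of the triple
`(R, ξ, X_s)`. -/
noncomputable def stepMap (κ : ℝ) (s t : ℝ≥0) (x : Fin 3 → ℝ) : ℝ × ℝ :=
  (x 2, ((t : ℝ) / s) ^ κ * (x 0 ^ κ * x 2 + (s : ℝ) ^ κ * (1 - x 0) ^ κ * x 1))

theorem measurable_stepMap (κ : ℝ) (s t : ℝ≥0) : Measurable (stepMap κ s t) := by
  unfold stepMap
  fun_prop

/-- Reorders `(H, Z_1, ξ)` into the independent triple `(R, ξ, X_s)` on `Fin 3`, the form needed for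
`iIndepFun`. -/
theorem map_prod_eq_pi {E : Type*} [MeasurableSpace E] {η : Measure E} {μ μ' : Measure ℝ}
    [IsProbabilityMeasure η] [IsProbabilityMeasure μ] [IsProbabilityMeasure μ']
    {f : E → ℝ} {g g' : ℝ → ℝ} (hf : Measurable f) (hg : Measurable g) (hg' : Measurable g') :
    (η.prod (μ.prod μ')).map (fun q => ![f q.1, g' q.2.2, g q.2.1]) =
      Measure.pi ![η.map f, μ'.map g', μ.map g] := by
  have := Measure.isProbabilityMeasure_map (μ := η) hf.aemeasurable
  have := Measure.isProbabilityMeasure_map (μ := μ) hg.aemeasurable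
  have := Measure.isProbabilityMeasure_map (μ := μ') hg'.aemeasurable
  have : ∀ i, SigmaFinite ((![η.map f, μ'.map g', μ.map g] : Fin 3 → Measure ℝ) i) := by
    intro i
    fin_cases i <;> simp <;> infer_instance
  refine (Measure.pi_eq fun A hA => ?_).symm
  have hm : Measurable fun q : E × ℝ × ℝ => ![f q.1, g' q.2.2, g q.2.1] := by
    refine measurable_pi_iff.2 fun i => ?_
    fin_cases i
    · exact hf.comp measurable_fst
    · exact hg'.comp (measurable_snd.comp measurable_snd)
    · exact hg.comp (measurable_fst.comp measurable_snd)
  rw [Measure.map_apply hm (MeasurableSet.univ_pi hA)]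
  have : (fun q : E × ℝ × ℝ => ![f q.1, g' q.2.2, g q.2.1]) ⁻¹' (Set.univ.pi A)
      = (f ⁻¹' A 0) ×ˢ ((g ⁻¹' A 2) ×ˢ (g' ⁻¹' A 1)) := by
    ext q
    simp only [Set.mem_preimage, Set.mem_univ_pi, Fin.forall_fin_succ, Set.mem_prod]
    simp
    tauto
  rw [this, Measure.prod_prod, Measure.prod_prod, Fin.prod_univ_three]
  simp only [Matrix.cons_val]
  rw [Measure.map_apply hf (hA 0), Measure.map_apply hg' (hA 1), Measure.map_apply hg (hA 2)]
  ring

/-- The law of `(X_s, X_t)` for a mimic, as the image of a product law. -/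
theorem IsMimic.map_pair {Ω' : Type*} [MeasurableSpace Ω'] {P' : Measure Ω'}
    [IsProbabilityMeasure P]
    [IsProbabilityMeasure P'] {κ : ℝ} (hκ : 0 < κ)
    {Z ζ : ℝ≥0 → Ω → ℝ} {X : ℝ≥0 → Ω' → ℝ} (hX : IsMimic κ Z ζ P X P')
    (hZ : IsLevyProcess Z P) (hζ : IsSubordinator ζ P)
    (hself : ∀ h : ℝ≥0, P.map (Z h) = (P.map (Z 1)).map (fun x => (h : ℝ) ^ κ * x))
    (hindep : IndepFun (fun ω t => Z t ω) (fun ω t => ζ t ω) P)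
    {s t : ℝ≥0} (hs : 0 < s) (hst : s ≤ t) :
    P'.map (fun ω => (X s ω, X t ω)) =
      (Measure.pi ![P.map fun ω => Real.exp (-ζ (Real.log ((t : ℝ) / s)).toNNReal ω),
        P.map (Z 1), P'.map (X s)]).map (stepMap κ s t) := by
  have hs0 : (0 : ℝ) < s := hs
  have ht0 : (0 : ℝ) < t := hs0.trans_le hst
  set u := (Real.log ((t : ℝ) / s)).toNNReal with hu
  have hH : Measurable (overshoot ζ u) :=
    ((hζ.measurable u).exp.sub measurable_const).real_toNNReal
  have := Measure.isProbabilityMeasure_map (μ := P) (hZ.measurable 1).aemeasurable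
  have := Measure.isProbabilityMeasure_map (μ := P) hH.aemeasurable
  have hind : IndepFun (fun ω t => Z t ω) (overshoot ζ u) P :=
    hindep.comp (φ := id) (ψ := fun p : ℝ≥0 → ℝ => (Real.exp (p u) - 1).toNNReal)
      measurable_id (by fun_prop)
  have htriple := map_randomTime hZ.measurable hZ.cadlag hH hind hκ
    fun h => hZ.map_pair h (hself h)
  let F : ℝ≥0 × ℝ × ℝ → ℝ × ℝ := fun q =>
    ((s : ℝ) ^ κ * q.2.1, (t : ℝ) ^ κ * (1 + (q.1 : ℝ))⁻¹ ^ κ * q.2.2)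
  have hF : Measurable F := by fun_prop
  -- With `a = -log s` the clock `a + log s` is `0`, where `ζ` vanishes, and `a + log t` is `log
  -- (t/s)`.
  have hchange : (fun ω => (timeChange κ Z ζ (-Real.log s) s ω,
      timeChange κ Z ζ (-Real.log s) t ω)) =ᵐ[P]
      F ∘ fun ω => (overshoot ζ u ω, Z 1 ω, Z (1 + overshoot ζ u ω) ω) := by
    filter_upwards [hζ.zero, hζ.nonneg u] with ω h0 hpos
    have hlog : (-Real.log s + Real.log t).toNNReal = u := by
      rw [hu, Real.log_div ht0.ne' hs0.ne']
      congr 1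
      ring
    simp only [timeChange, hlog, F, Function.comp_apply, inv_one_add_overshoot hpos,
      one_add_overshoot hpos, ← Real.exp_mul]
    simp [h0, mul_comm κ]
  have hexp : Real.exp (- -Real.log s) = s := by rw [neg_neg, Real.exp_log hs0]
  have hpair := (hX.identDistrib_pair (a := -Real.log s) (s := s) (t := t) hexp.le
    (hexp.le.trans hst)).map_eq
  have hmH : AEMeasurable (fun ω => (overshoot ζ u ω, Z 1 ω, Z (1 + overshoot ζ u ω) ω)) P :=
    hH.aemeasurable.prodMk ((hZ.measurable 1).aemeasurable.prodMk
      (aemeasurable_randomTime hZ.measurable hZ.cadlag hH))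
  have hmG : Measurable fun q : ℝ≥0 × ℝ × ℝ =>
    (q.1, q.2.1, q.2.1 + (q.1 : ℝ) ^ κ * q.2.2) := by fun_prop
  rw [Measure.map_congr hchange, ← AEMeasurable.map_map_of_aemeasurable hF.aemeasurable hmH,
    htriple, Measure.map_map hF hmG] at hpair
  have hXs : P'.map (X s) = (P.map (Z 1)).map fun x => (s : ℝ) ^ κ * x := by
    have h1 := congrArg (Measure.map Prod.fst) hpair
    rw [Measure.map_map measurable_fst ((hX.measurable s).prodMk (hX.measurable t)),
      Measure.map_map measurable_fst (hF.comp hmG)] at h1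
    have h2 : Prod.fst ∘ F ∘ (fun q : ℝ≥0 × ℝ × ℝ =>
        (q.1, q.2.1, q.2.1 + (q.1 : ℝ) ^ κ * q.2.2)) =
        (fun x => (s : ℝ) ^ κ * x) ∘ Prod.fst ∘ Prod.snd := rfl
    have hm : Measurable fun x : ℝ => (s : ℝ) ^ κ * x := by fun_prop
    have hm' : Measurable (Prod.fst ∘ Prod.snd : ℝ≥0 × ℝ × ℝ → ℝ) :=
      measurable_fst.comp measurable_snd
    rw [h2, ← Measure.map_map hm hm', ← Measure.map_map measurable_fst measurable_snd, Measure.map_snd_prod,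
      measure_univ, one_smul, Measure.map_fst_prod, measure_univ, one_smul] at h1
    exact h1
  have hR : P.map (fun ω => Real.exp (-ζ u ω)) =
      (P.map (overshoot ζ u)).map fun h : ℝ≥0 => (1 + (h : ℝ))⁻¹ := by
    rw [Measure.map_map (by fun_prop) hH]
    refine Measure.map_congr ?_
    filter_upwards [hζ.nonneg u] with ω hpos
    exact (inv_one_add_overshoot hpos).symm
  have hpi := map_prod_eq_pi (η := P.map (overshoot ζ u)) (μ := P.map (Z 1)) (μ' := P.map (Z 1))
    (f := fun h : ℝ≥0 => (1 + (h : ℝ))⁻¹) (g := fun x => (s : ℝ) ^ κ * x) (g' := id) (by fun_prop)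
    (by fun_prop) measurable_id
  rw [Measure.map_id, ← hR, ← hXs] at hpi
  have hmV : Measurable fun q : ℝ≥0 × ℝ × ℝ =>
      ![(1 + (q.1 : ℝ))⁻¹, id q.2.2, (s : ℝ) ^ κ * q.2.1] := by
    refine measurable_pi_iff.2 fun i => ?_
    fin_cases i <;> simp <;> fun_prop
  rw [hpair, ← hpi, Measure.map_map (measurable_stepMap κ s t) hmV]
  congr 1
  funext ⟨h, z, y⟩
  have hh : (0 : ℝ) < 1 + h := by positivity
  -- This is `1 - R = R H`, which turns `R^κ H^κ` into `(1 - R)^κ`.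
  have e1 : 1 - (1 + (h : ℝ))⁻¹ = (1 + (h : ℝ))⁻¹ * h := by field_simp; ring
  have e2 : ((t : ℝ) / s) ^ κ * (s : ℝ) ^ κ = (t : ℝ) ^ κ := by
    rw [← Real.mul_rpow (by positivity) hs0.le, div_mul_cancel₀ _ hs0.ne']
  simp only [F, stepMap, Function.comp_apply, Matrix.cons_val, id, Prod.mk.injEq, true_and]
  rw [e1, Real.mul_rpow (by positivity) (by positivity), ← e2]
  ring

end StableMimic

/-! ### Construction on the enlarged space. -/

theorem mainTheorem10 {Ω : Type*} {Ω' : Type v} [MeasurableSpace Ω] [MeasurableSpace Ω']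
    (P : Measure Ω) [IsProbabilityMeasure P] (P' : Measure Ω') [IsProbabilityMeasure P']
    (α κ : ℝ) (hα₁ : 1 < α) (hα₂ : α < 2) (hκ : κ = 1 / α)
    (Z : ℝ≥0 → Ω → ℝ) (hZ : StableMimic.IsStableLevyProcess α Z P)
    (hZmart : Martingale Z
      (Filtration.natural Z (fun t => (hZ.measurable t).stronglyMeasurable)) P)
    (ζ : ℝ≥0 → Ω → ℝ) (hζ : StableMimic.IsSubordinator ζ P)
    (hindep : IndepFun (fun ω t => Z t ω) (fun ω t => ζ t ω) P)
    (X : ℝ≥0 → Ω' → ℝ) (hX : StableMimic.IsMimic κ Z ζ P X P') :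
    ∃ (Ω'' : Type v) (_ : MeasurableSpace Ω'') (P'' : Measure Ω'') (_ : IsProbabilityMeasure P'')
      (π : Ω'' → Ω') (R ξ : ℝ≥0 → ℝ≥0 → Ω'' → ℝ),
      MeasurePreserving π P'' P' ∧
      ∀ s t : ℝ≥0, 0 < s → s ≤ t →
        Measurable (R s t) ∧ Measurable (ξ s t) ∧
        IdentDistrib (R s t) (fun ω => Real.exp (-ζ (Real.log ((t : ℝ) / s)).toNNReal ω)) P'' P ∧
        IdentDistrib (ξ s t) (Z 1) P'' P ∧
        iIndepFun ![R s t, ξ s t, fun ω => X s (π ω)] P'' ∧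
        ∀ᵐ ω ∂P'', X t (π ω) =
          ((t : ℝ) / s) ^ κ *
            (R s t ω ^ κ * X s (π ω) + (s : ℝ) ^ κ * (1 - R s t ω) ^ κ * ξ s t ω) := by
  have hκ0 : 0 < κ := by rw [hκ]; positivity
  have hself := hZ.map_eq hα₁ hα₂ (hZmart.integrable 1)
    (StableMimic.integral_eq_zero_of_martingale hZmart hZ.zero 1)
  rw [← hκ] at hself
  let Q : ℝ≥0 → ℝ≥0 → Fin 3 → Measure ℝ := fun s t =>
    ![P.map fun ω => Real.exp (-ζ (Real.log ((t : ℝ) / s)).toNNReal ω), P.map (Z 1), P'.map (X s)]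
  have hexp (s t : ℝ≥0) :
      Measurable fun ω => Real.exp (-ζ (Real.log ((t : ℝ) / s)).toNNReal ω) :=
    (hζ.measurable _).neg.exp
  have hQ (s t : ℝ≥0) (i : Fin 3) : IsProbabilityMeasure (Q s t i) := by
    fin_cases i
    · exact Measure.isProbabilityMeasure_map (hexp s t).aemeasurable
    · exact Measure.isProbabilityMeasure_map (hZ.measurable 1).aemeasurable
    · exact Measure.isProbabilityMeasure_map (hX.measurable s).aemeasurable
  -- One uniform variable serves all pairs `(s, t)`, since nothing is claimed jointly over different
  -- pairs. Outside `0 < s ≤ t`, `V` is a dummy.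
  have hV : ∀ s t : ℝ≥0, ∃ V : Ω' × unitInterval → Fin 3 → ℝ, 0 < s → s ≤ t → Measurable V ∧
      (P'.prod (volume : Measure unitInterval)).map V = Measure.pi (Q s t) ∧
      ∀ᵐ ω ∂(P'.prod (volume : Measure unitInterval)),
        StableMimic.stepMap κ s t (V ω) = (X s ω.1, X t ω.1) := by
    intro s t
    by_cases h : 0 < s ∧ s ≤ t
    · obtain ⟨V, hV⟩ := StableMimic.exists_transfer P' (Measure.pi (Q s t))
        ((hX.measurable s).prodMk (hX.measurable t)) (StableMimic.measurable_stepMap κ s t)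
        (hX.map_pair hκ0 hZ.toIsLevyProcess hζ hself hindep h.1 h.2)
      exact ⟨V, fun _ _ => hV⟩
    · exact ⟨fun _ _ => 0, fun h1 h2 => absurd ⟨h1, h2⟩ h⟩
  choose V hV using hV
  refine ⟨Ω' × unitInterval, inferInstance, P'.prod volume, inferInstance, Prod.fst,
    fun s t ω => V s t ω 0, fun s t ω => V s t ω 1, measurePreserving_fst, fun s t hs hst => ?_⟩
  obtain ⟨hVm, hVlaw, hVeq⟩ := hV s t hs hst
  have hcoord (i : Fin 3) : Measurable fun ω => V s t ω i := (measurable_pi_apply i).comp hVm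
  have hmarg (i : Fin 3) :
      (P'.prod (volume : Measure unitInterval)).map (fun ω => V s t ω i) = Q s t i := by
    rw [← (measurePreserving_eval (Q s t) i).map_eq, ← hVlaw,
      Measure.map_map (measurable_pi_apply i) hVm]
    rfl
  refine ⟨hcoord 0, hcoord 1, ⟨(hcoord 0).aemeasurable, (hexp s t).aemeasurable, hmarg 0⟩,
    ⟨(hcoord 1).aemeasurable, (hZ.measurable 1).aemeasurable, hmarg 1⟩, ?_, ?_⟩
  · have hind : iIndepFun (fun i ω => V s t ω i) (P'.prod (volume : Measure unitInterval)) := by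
      rw [iIndepFun_iff_map_fun_eq_pi_map fun i => (hcoord i).aemeasurable]
      simp only [hmarg]
      exact hVlaw
    -- The first component of `stepMap` retains `X_s`, so the third coordinate of `V` is almost
    -- surely the given `X_s`, not merely a copy in law.
    refine hind.congr fun i => ?_
    fin_cases i
    · exact ae_of_all _ fun _ => rfl
    · exact ae_of_all _ fun _ => rfl
    · filter_upwards [hVeq] with ω hω
      exact congrArg Prod.fst hω
  · filter_upwards [hVeq] with ω hω
    have h2 : V s t ω 2 = X s ω.1 := congrArg Prod.fst hω
    have h3 := congrArg Prod.snd hω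
    simp only [StableMimic.stepMap, h2] at h3
    exact h3.symm
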